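/- Modal formulas are built from countably many variables with the connectives $\wedge,\vee,\cdot,\to$, the constants $0,1$ and the modalities $\Box,\Diamond$. Let $[0,1]_{Ł}$ be the standard MV algebra on $[0,1]$ with the usual order, $a\cdot b=\max\{0,a+b-1\}$ and $a\to b=\min\{1,1-a+b\}$, and for $n\ge 1$ let $MV_n$ be its subalgebra with universe $\{0,\frac1n,\dots,\frac nn\}$. A Kripke model over such an algebra $A$ is a triple $\langle W,R,e\rangle$ with $W\neq\emptyset$, $R\subseteq W\times W$ and $e$ assigning to each variable and each world an element of $A$; $e$ is extended to all formulas so that it commutes with the propositional connectives at every world and $e(v,\Box\varphi)=\bigwedge_{Rvw}e(w,\varphi)$, $e(v,\Diamond\varphi)=\bigvee_{Rvw}e(w,\varphi)$, where the infima and suprema are taken in $A$ (they always exist for these algebras). Let $K_{Ł}$ be the class of Kripke models over $[0,1]_{Ł}$ and $K_{\omega Ł}$ the class of Kripke models over the algebras $MV_n$, $n\ge1$; for a class $C$ of models let $4C$ be the class of those models in $C$ whose relation $R$ is transitive. For a finite set of formulas $\Gamma$ and a formula $\varphi$, write $\Gamma\vdash_C\varphi$ if for every model in $C$ and every world $v$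 of it, $e(v,\gamma)=1$ for all $\gamma\in\Gamma$ implies $e(v,\varphi)=1$. Then: 1. $\vdash_{K_{\omega Ł}}$ coincides with $\vdash_{K_{Ł}}$: for every finite $\Gamma$ and every $\varphi$, $\Gamma\vdash_{K_{\omega Ł}}\varphi$ if and only if $\Gamma\vdash_{K_{Ł}}\varphi$. 2. $\vdash_{4K_{\omega Ł}}$ is strictly stronger than $\vdash_{4K_{Ł}}$: $\Gamma\vdash_{4K_{Ł}}\varphi$ implies $\Gamma\vdash_{4K_{\omega Ł}}\varphi$ for every finite $\Gamma$ and every $\varphi$, and there are a finite $\Gamma$ and a $\varphi$ with $\Gamma\vdash_{4K_{\omega Ł}}\varphi$ and $\Gamma\not\vdash_{4K_{Ł}}\varphi$. 3. There is no set $G4$ of axioms and inference rules (possibly with infinitely many premises, and possibly including rules that may be applied to theorems only, such as necessitation) such that both the extension of $\vdash_{K_{Ł}}$ with $G4$ coincides with $\vdash_{4K_{Ł}}$ and the extension of $\vdash_{K_{\omega Ł}}$ with $G4$ coincides with $\vdash_{4K_{\omega Ł}}$ (as relations between finite sets of formulas and formulas). Here, $\varphi$ follows from $\Gamma$ in the extension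 of a logic $\vdash$ with $G4$ if $\varphi$ is derivable from $\Gamma$ by means of $\vdash$ and the axioms and rules in $G4$. -/

import Mathlib

/-- An `FL_ew`-algebra `⟨A; ∧, ∨, ·, →, 0, 1⟩`: a bounded lattice (`0 = ⊥`, `1 = ⊤`) with a commutative
monoid operation whose unit is the top element, and a residual `→` of the monoid operation. -/
structure FLewAlgebra where
  carrier : Type
  [lattice : Lattice carrier]
  [bounded : BoundedOrder carrier]
  mul : carrier → carrier → carrier
  imp : carrier → carrier → carrier
  mul_assoc : ∀ a b c, mul (mul a b) c = mul a (mul b c)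
  mul_comm : ∀ a b, mul a b = mul b a
  mul_top : ∀ a, mul a ⊤ = a
  residuation : ∀ a b c, mul a b ≤ c ↔ a ≤ imp b c

attribute [instance] FLewAlgebra.lattice FLewAlgebra.bounded

/-- The Łukasiewicz algebra on a set `S ⊆ [0,1]` of reals that contains `0` and `1` and is closed under
`a · b = max {0, a + b - 1}` and `a → b = min {1, 1 - a + b}`, with the usual order. -/
noncomputable def lukasiewiczOn (S : Set ℝ) (hS : S ⊆ Set.Icc 0 1)
    (h0 : (0 : ℝ) ∈ S) (h1 : (1 : ℝ) ∈ S)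
    (hmul : ∀ a ∈ S, ∀ b ∈ S, max 0 (a + b - 1) ∈ S)
    (himp : ∀ a ∈ S, ∀ b ∈ S, min 1 (1 - a + b) ∈ S) : FLewAlgebra where
  carrier := S
  bounded :=
    { top := ⟨1, h1⟩
      le_top := fun a => (hS a.2).2
      bot := ⟨0, h0⟩
      bot_le := fun a => (hS a.2).1 }
  mul a b := ⟨max 0 (a.1 + b.1 - 1), hmul a.1 a.2 b.1 b.2⟩
  imp a b := ⟨min 1 (1 - a.1 + b.1), himp a.1 a.2 b.1 b.2⟩
  mul_assoc a b c := by
    have ha := hS a.2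
    have hc := hS c.2
    apply Subtype.ext
    simp only [Set.mem_Icc] at ha hc ⊢
    grind
  mul_comm a b := by
    apply Subtype.ext
    simp only [add_comm]
  mul_top a := by
    have ha := hS a.2
    apply Subtype.ext
    change max 0 (a.1 + 1 - 1) = a.1
    simp only [Set.mem_Icc] at ha
    grind
  residuation a b c := by
    have ha := hS a.2
    have hc := hS c.2
    change max 0 (a.1 + b.1 - 1) ≤ c.1 ↔ a.1 ≤ min 1 (1 - b.1 + c.1)
    simp only [Set.mem_Icc] at ha hc
    grind

/-- The standard MV algebra `[0,1]_Ł`. -/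
noncomputable def standardMV : FLewAlgebra :=
  lukasiewiczOn (Set.Icc 0 1) subset_rfl (by norm_num) (by norm_num)
    (by intro a ha b hb; simp only [Set.mem_Icc] at *; grind)
    (by intro a ha b hb; simp only [Set.mem_Icc] at *; grind)

/-- The finite MV algebra `MV_n`, `n ≥ 1`, of `n + 1` elements: the subalgebra of `[0,1]_Ł` with universe
`{0, 1/n, …, n/n}`. -/
noncomputable def finiteMV (n : ℕ+) : FLewAlgebra :=
  lukasiewiczOn {x : ℝ | ∃ k : ℕ, k ≤ (n : ℕ) ∧ x = (k : ℝ) / (n : ℕ)}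
    (by
      rintro x ⟨k, hk, rfl⟩
      have hn : (0 : ℝ) < (n : ℕ) := by exact_mod_cast n.pos
      have hk' : (k : ℝ) ≤ (n : ℕ) := by exact_mod_cast hk
      exact ⟨by positivity, (div_le_one hn).2 hk'⟩)
    ⟨0, Nat.zero_le _, by simp⟩
    ⟨n, le_rfl, by
      have hn : (0 : ℝ) < (n : ℕ) := by exact_mod_cast n.pos
      exact (div_self hn.ne').symm⟩
    (by
      rintro a ⟨k, hk, rfl⟩ b ⟨l, hl, rfl⟩
      have hn : (0 : ℝ) < (n : ℕ) := by exact_mod_cast n.pos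
      rcases le_total (k + l) (n : ℕ) with h | h
      · refine ⟨0, Nat.zero_le _, ?_⟩
        have h' : (k : ℝ) + l ≤ (n : ℕ) := by exact_mod_cast h
        rw [max_eq_left]
        · simp
        · rw [← add_div, sub_nonpos, div_le_one hn]
          exact h'
      · refine ⟨k + l - n, by omega, ?_⟩
        have h' : ((n : ℕ) : ℝ) ≤ (k : ℝ) + l := by exact_mod_cast h
        rw [max_eq_right]
        · rw [Nat.cast_sub h]
          push_cast
          field_simp
        · rw [← add_div, sub_nonneg, one_le_div hn]
          exact h')
    (by
      rintro a ⟨k, hk, rfl⟩ b ⟨l, hl, rfl⟩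
      have hn : (0 : ℝ) < (n : ℕ) := by exact_mod_cast n.pos
      rcases le_total k l with h | h
      · refine ⟨n, le_rfl, ?_⟩
        have h' : (k : ℝ) / (n : ℕ) ≤ (l : ℝ) / (n : ℕ) := by
          gcongr
        rw [min_eq_left (by linarith), div_self hn.ne']
      · refine ⟨n - k + l, by omega, ?_⟩
        have h' : (l : ℝ) / (n : ℕ) ≤ (k : ℝ) / (n : ℕ) := by
          gcongr
        rw [min_eq_right (by linarith)]
        push_cast [Nat.cast_sub hk]
        field_simp)

/-- Modal formulas over the countable set of variables `p₀, p₁, …`. -/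
inductive ModalFormula where
  | var (i : ℕ)
  | zero
  | one
  | and (φ ψ : ModalFormula)
  | or (φ ψ : ModalFormula)
  | mul (φ ψ : ModalFormula)
  | imp (φ ψ : ModalFormula)
  | box (φ : ModalFormula)
  | dia (φ : ModalFormula)

universe u

/-- An `A`-Kripke model `⟨W, R, e⟩`, bundled with the `FL_ew`-algebra `A` over which it is evaluated.
The accessibility relation is crisp. -/
structure KripkeModel where
  alg : FLewAlgebra
  World : Type u
  [nonempty : Nonempty World]
  R : World → World → Prop
  e : ℕ → World → alg.carrier

/-- `M.HasValue φ v a` says that the (partially defined) value `e(v, φ)` is defined and equal to `a`.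
The value of `□φ` (of `◇φ`) at `v` is the infimum (supremum) in the algebra of the values of `φ` at the
successors of `v`, and it is undefined if one of these values is, or if the infimum (supremum) does not
exist. -/
def KripkeModel.HasValue (M : KripkeModel.{u}) :
    ModalFormula → M.World → M.alg.carrier → Prop
  | .var i, v, a => a = M.e i v
  | .zero, _, a => a = ⊥
  | .one, _, a => a = ⊤
  | .and φ ψ, v, a => ∃ b c, M.HasValue φ v b ∧ M.HasValue ψ v c ∧ a = b ⊓ c
  | .or φ ψ, v, a => ∃ b c, M.HasValue φ v b ∧ M.HasValue ψ v c ∧ a = b ⊔ c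
  | .mul φ ψ, v, a => ∃ b c, M.HasValue φ v b ∧ M.HasValue ψ v c ∧ a = M.alg.mul b c
  | .imp φ ψ, v, a => ∃ b c, M.HasValue φ v b ∧ M.HasValue ψ v c ∧ a = M.alg.imp b c
  | .box φ, v, a => (∀ w, M.R v w → ∃ b, M.HasValue φ w b) ∧
      IsGLB {b | ∃ w, M.R v w ∧ M.HasValue φ w b} a
  | .dia φ, v, a => (∀ w, M.R v w → ∃ b, M.HasValue φ w b) ∧
      IsLUB {b | ∃ w, M.R v w ∧ M.HasValue φ w b} a

/-- A model is safe if every formula has a value at every world. -/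
def KripkeModel.Safe (M : KripkeModel.{u}) : Prop :=
  ∀ φ v, ∃ a, M.HasValue φ v a

/-- `M, v ⊨ φ`, that is, `e(v, φ) = 1`. -/
def KripkeModel.Satisfies (M : KripkeModel.{u}) (v : M.World) (φ : ModalFormula) : Prop :=
  M.HasValue φ v ⊤

/-- The class `K_𝒜` of safe Kripke models over the algebras in the class `𝒜`. -/
def safeModels (𝒜 : Set FLewAlgebra) : Set KripkeModel.{u} :=
  {M | M.alg ∈ 𝒜 ∧ M.Safe}

/-- The class `4C` of transitive models in the class `C`. -/
def transitiveModels (C : Set KripkeModel.{u}) : Set KripkeModel.{u} :=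
  {M | M ∈ C ∧ ∀ x y z, M.R x y → M.R y z → M.R x z}

/-- The class `K_Ł` of Kripke models over the standard MV algebra. -/
def modelsL : Set KripkeModel.{u} := safeModels {standardMV}

/-- The class `K_ωŁ` of Kripke models over the finite MV algebras `MV_n`, `n ≥ 1`. -/
def modelsFinL : Set KripkeModel.{u} := safeModels (Set.range finiteMV)

/-- Consequence relations from finite sets of formulas to formulas. -/
abbrev ConsequenceRel := Finset ModalFormula → ModalFormula → Prop

/-- Local consequence `Γ ⊢_C φ` over a class `C` of models, for finite `Γ`. -/
def localConsequence (C : Set KripkeModel.{u}) : ConsequenceRel := fun Γ φ =>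
  ∀ M ∈ C, ∀ v : M.World, (∀ γ ∈ Γ, M.Satisfies v γ) → M.Satisfies v φ

/-- An inference rule (or an instance of one), with an arbitrary set of premises. -/
structure InferenceRule where
  premises : Set ModalFormula
  conclusion : ModalFormula

/-- A set of axioms and rules. An axiom or rule that is schematic is given by the set of all its instances.
The members of `rules` may be applied to arbitrary derived formulas, those of `theoremRules` only to
theorems (as is usual for necessitation in local modal logics). -/
structure AxiomsAndRules where
  postulates : Set ModalFormula
  rules : Set InferenceRule
  theoremRules : Set InferenceRule

/-- `ExtensionBy L G Γ φ`: the formula `φ` is derivable from `Γ` in the extension of the logic `L`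
with the axioms and rules in `G`. -/
inductive ExtensionBy (L : ConsequenceRel) (G : AxiomsAndRules) :
    Set ModalFormula → ModalFormula → Prop
  | premise {Γ : Set ModalFormula} {φ : ModalFormula} : φ ∈ Γ → ExtensionBy L G Γ φ
  | logic {Γ : Set ModalFormula} {Δ : Finset ModalFormula} {φ : ModalFormula} :
      L Δ φ → (∀ δ ∈ Δ, ExtensionBy L G Γ δ) → ExtensionBy L G Γ φ
  | postulate {Γ : Set ModalFormula} {φ : ModalFormula} :
      φ ∈ G.postulates → ExtensionBy L G Γ φ
  | rule {Γ : Set ModalFormula} (r : InferenceRule) :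
      r ∈ G.rules → (∀ δ ∈ r.premises, ExtensionBy L G Γ δ) → ExtensionBy L G Γ r.conclusion
  | theoremRule {Γ : Set ModalFormula} (r : InferenceRule) :
      r ∈ G.theoremRules → (∀ δ ∈ r.premises, ExtensionBy L G ∅ δ) →
        ExtensionBy L G Γ r.conclusion

/-- The extension of `L` with the axioms and rules in `G`, as a relation on finite sets of premises. -/
def extension (L : ConsequenceRel) (G : AxiomsAndRules) : ConsequenceRel := fun Γ φ =>
  ExtensionBy L G (Γ : Set ModalFormula) φ

/-! The third claim is formal once the other two are known: equal base logics have equal extensions,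
while the two transitive logics differ.

For the first claim, a countermodel over `[0,1]` must be turned into one over some `MV_n`. Its
ultrapower (`exists_witnessed`) has the same values at a diagonal world, and there every infimum and
supremum is attained. For finitely many formulas it then suffices to keep one witness per formula
and modality, level by level, so only finitely many real values matter. A `ℚ`-linear map normalised
to fix `1` sends these to fractions with a common denominator without changing their order
(`exists_addMonoidHom_rational`). Additivity, order and `L 1 = 1` are all that the connectives and
attained infima see, so the map transports truth values (`value_levelRel`). The unravelling into
levels is not transitive, so this says nothing about transitive models.

For the second claim, `halvingPremises` asks that `p₀` be `1/2` and that `p₀ = min 1 (2 ◇p₀)` here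
and at all successors. Suprema in `MV_n` are attained, so transitivity yields values `1/2, 1/4, 1/8,
…` forever, which a finite chain does not contain; over `[0,1]` the frame `(ℕ, <)` satisfies the
premises. -/

open Filter Topology

/-! ### Real-valued semantics and its agreement with the Kripke models -/

/-- The infimum of `1` and the values of `F` at the successors of `v`. -/
noncomputable def boxVal {W : Type*} (R : W → W → Prop) (F : W → ℝ) (v : W) : ℝ :=
  sInf (insert 1 (F '' {w | R v w}))

section boxVal

variable {W : Type*} {R : W → W → Prop} {F : W → ℝ} {v : W}

theorem isGLB_boxVal (hF : ∀ w, 0 ≤ F w) :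
    IsGLB (insert 1 (F '' {w | R v w})) (boxVal R F v) := by
  refine isGLB_csInf (Set.insert_nonempty _ _) ⟨0, ?_⟩
  rintro x (rfl | ⟨w, -, rfl⟩)
  · exact zero_le_one
  · exact hF w

theorem boxVal_le (hF : ∀ w, 0 ≤ F w) {w : W} (h : R v w) : boxVal R F v ≤ F w :=
  (isGLB_boxVal hF).1 (Or.inr ⟨w, h, rfl⟩)

/-- This is the purpose of the inserted `1`: the real `sInf ∅` is `0`, but a box without successors
must be `1`. -/
theorem boxVal_eq_one (h : ¬ ∃ w, R v w) : boxVal R F v = 1 := by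
  have : {w | R v w} = ∅ := Set.eq_empty_of_forall_notMem fun w hw => h ⟨w, hw⟩
  simp [boxVal, this]

theorem boxVal_eq_of_forall_le {w : W} (h : R v w) (h1 : F w ≤ 1)
    (hle : ∀ u, R v u → F w ≤ F u) : boxVal R F v = F w := by
  refine IsLeast.csInf_eq ⟨Or.inr ⟨w, h, rfl⟩, ?_⟩
  rintro x (rfl | ⟨u, hu, rfl⟩)
  · exact h1
  · exact hle u hu

theorem exists_lt_boxVal_add (hF : ∀ w, F w ∈ Set.Icc (0 : ℝ) 1) (h : ∃ w, R v w) {ε : ℝ}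
    (hε : 0 < ε) : ∃ w, R v w ∧ F w < boxVal R F v + ε := by
  obtain ⟨x, hx, hlt⟩ := (isGLB_lt_iff (isGLB_boxVal (R := R) (v := v) fun w => (hF w).1)).1
    (lt_add_of_pos_right (boxVal R F v) hε)
  rcases hx with rfl | ⟨w, hw, rfl⟩
  · obtain ⟨w, hw⟩ := h
    exact ⟨w, hw, (hF w).2.trans_lt hlt⟩
  · exact ⟨w, hw, hlt⟩

end boxVal

/-- The real-valued Łukasiewicz semantics of modal formulas. -/
noncomputable def value {W : Type*} (R : W → W → Prop) (e : ℕ → W → ℝ) : ModalFormula → W → ℝ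
  | .var i, v => e i v
  | .zero, _ => 0
  | .one, _ => 1
  | .and φ ψ, v => min (value R e φ v) (value R e ψ v)
  | .or φ ψ, v => max (value R e φ v) (value R e ψ v)
  | .mul φ ψ, v => max 0 (value R e φ v + value R e ψ v - 1)
  | .imp φ ψ, v => min 1 (1 - value R e φ v + value R e ψ v)
  | .box φ, v => boxVal R (value R e φ) v
  -- Łukasiewicz negation is an order-reversing involution, so one infimum operator serves both
  -- modalities.
  | .dia φ, v => 1 - boxVal R (fun w => 1 - value R e φ w) v

/-- A set of reals that is the universe of a complete subalgebra of `[0,1]_Ł`. -/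
structure IsLukasiewiczSet (S : Set ℝ) : Prop where
  subset_Icc : S ⊆ Set.Icc 0 1
  zero_mem : (0 : ℝ) ∈ S
  one_mem : (1 : ℝ) ∈ S
  mul_mem : ∀ a ∈ S, ∀ b ∈ S, max 0 (a + b - 1) ∈ S
  imp_mem : ∀ a ∈ S, ∀ b ∈ S, min 1 (1 - a + b) ∈ S
  sInf_mem : ∀ T ⊆ S, sInf (insert 1 T) ∈ S

namespace IsLukasiewiczSet

variable {S : Set ℝ}

/-- The Łukasiewicz algebra with universe `S`. -/
noncomputable abbrev alg (hS : IsLukasiewiczSet S) : FLewAlgebra :=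
  lukasiewiczOn S hS.subset_Icc hS.zero_mem hS.one_mem hS.mul_mem hS.imp_mem

/-- The Kripke model over the Łukasiewicz algebra with universe `S` given by a frame and a valuation. -/
noncomputable abbrev model (hS : IsLukasiewiczSet S) (W : Type u) [Nonempty W] (R : W → W → Prop)
    (e : ℕ → W → S) : KripkeModel.{u} :=
  ⟨hS.alg, W, R, e⟩

theorem one_sub_mem (hS : IsLukasiewiczSet S) {a : ℝ} (ha : a ∈ S) : 1 - a ∈ S := by
  have := hS.imp_mem a ha 0 hS.zero_mem
  rwa [add_zero, min_eq_right (by linarith [(hS.subset_Icc ha).1])] at this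

theorem value_mem (hS : IsLukasiewiczSet S) {W : Type*} {R : W → W → Prop} {e : ℕ → W → ℝ}
    (he : ∀ i v, e i v ∈ S) (φ : ModalFormula) (v : W) : value R e φ v ∈ S := by
  induction φ generalizing v with
  | var i => exact he i v
  | zero => exact hS.zero_mem
  | one => exact hS.one_mem
  | and φ ψ hφ hψ =>
    simp only [value]
    rcases min_choice (value R e φ v) (value R e ψ v) with h | h <;> rw [h]
    exacts [hφ v, hψ v]
  | or φ ψ hφ hψ =>
    simp only [value]
    rcases max_choice (value R e φ v) (value R e ψ v) with h | h <;> rw [h]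
    exacts [hφ v, hψ v]
  | mul φ ψ hφ hψ => exact hS.mul_mem _ (hφ v) _ (hψ v)
  | imp φ ψ hφ hψ => exact hS.imp_mem _ (hφ v) _ (hψ v)
  | box φ hφ => exact hS.sInf_mem _ (Set.image_subset_iff.2 fun w _ => hφ w)
  | dia φ hφ =>
    exact hS.one_sub_mem
      (hS.sInf_mem _ (Set.image_subset_iff.2 fun w _ => hS.one_sub_mem (hφ w)))

/-- By `sInf_mem` the real infimum lies in `S`, hence is also the infimum taken inside `S`. Thus
values always exist and safety is automatic. -/
theorem hasValue_iff (hS : IsLukasiewiczSet S) (W : Type u) [Nonempty W] (R : W → W → Prop)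
    (e : ℕ → W → S) (φ : ModalFormula) (v : W) (a : S) :
    (hS.model W R e).HasValue φ v a ↔ (a : ℝ) = value R (fun i w => (e i w : ℝ)) φ v := by
  have hmem := hS.value_mem (R := R) (e := fun i w => (e i w : ℝ)) fun i v => (e i v).2
  induction φ generalizing v a with
  | var i => exact Subtype.ext_iff
  | zero => exact Subtype.ext_iff
  | one => exact Subtype.ext_iff
  | and φ ψ hφ hψ | or φ ψ hφ hψ | mul φ ψ hφ hψ | imp φ ψ hφ hψ =>
    constructor
    · rintro ⟨b, c, hb, hc, rfl⟩
      have hb' := (hφ v b).1 hb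
      have hc' := (hψ v c).1 hc
      simp only [value]
      rw [← hb', ← hc']
      rfl
    · intro h
      refine ⟨⟨_, hmem φ v⟩, ⟨_, hmem ψ v⟩, (hφ _ _).2 rfl, (hψ _ _).2 rfl, Subtype.ext ?_⟩
      exact h
  | box φ hφ =>
    have hglb : IsGLB {b : S | ∃ w, R v w ∧ (hS.model W R e).HasValue φ w b}
        ⟨_, hmem (.box φ) v⟩ := by
      have key := isGLB_boxVal (R := R) (v := v) (F := value R (fun i w => (e i w : ℝ)) φ)
        fun w => (hS.subset_Icc (hmem φ w)).1
      refine ⟨?_, fun c hc => ?_⟩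
      · rintro b ⟨w, hw, hb⟩
        exact (key.1 (Or.inr ⟨w, hw, rfl⟩)).trans_eq ((hφ w b).1 hb).symm
      · refine key.2 ?_
        rintro x (rfl | ⟨w, hw, rfl⟩)
        · exact (hS.subset_Icc c.2).2
        · exact hc (a := ⟨_, hmem φ w⟩) ⟨w, hw, (hφ _ _).2 rfl⟩
    constructor
    · rintro ⟨-, h⟩
      exact congrArg Subtype.val (h.unique hglb)
    · intro h
      obtain rfl : a = ⟨_, hmem (.box φ) v⟩ := Subtype.ext h
      exact ⟨fun w _ => ⟨⟨_, hmem φ w⟩, (hφ _ _).2 rfl⟩, hglb⟩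
  | dia φ hφ =>
    have hlub : IsLUB {b : S | ∃ w, R v w ∧ (hS.model W R e).HasValue φ w b}
        ⟨_, hmem (.dia φ) v⟩ := by
      have key := isGLB_boxVal (R := R) (v := v)
        (F := fun w => 1 - value R (fun i w => (e i w : ℝ)) φ w)
        fun w => sub_nonneg.2 (hS.subset_Icc (hmem φ w)).2
      refine ⟨?_, fun c hc => ?_⟩
      · rintro b ⟨w, hw, hb⟩
        have := key.1 (Or.inr ⟨w, hw, rfl⟩)
        exact ((hφ w b).1 hb).trans_le (le_sub_comm.1 this)
      · refine sub_le_comm.1 (key.2 ?_)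
        rintro x (rfl | ⟨w, hw, rfl⟩)
        · exact sub_le_self _ (hS.subset_Icc c.2).1
        · exact sub_le_sub_left (α := ℝ)
            (hc (a := ⟨_, hmem φ w⟩) ⟨w, hw, (hφ _ _).2 rfl⟩) 1
    constructor
    · rintro ⟨-, h⟩
      exact congrArg Subtype.val (h.unique hlub)
    · intro h
      obtain rfl : a = ⟨_, hmem (.dia φ) v⟩ := Subtype.ext h
      exact ⟨fun w _ => ⟨⟨_, hmem φ w⟩, (hφ _ _).2 rfl⟩, hlub⟩

end IsLukasiewiczSet

/-- Local consequence in the real-valued models with values in `S` over the frames in `P`. -/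
def RealConsequence (P : ∀ W : Type u, (W → W → Prop) → Prop) (S : Set ℝ) : ConsequenceRel :=
  fun Γ φ => ∀ (W : Type u) (R : W → W → Prop) (e : ℕ → W → ℝ), P W R → (∀ i v, e i v ∈ S) →
    ∀ v, (∀ γ ∈ Γ, value R e γ v = 1) → value R e φ v = 1

/-- The frame condition `P` is a parameter so that arbitrary and transitive frames are handled at
once. -/
theorem IsLukasiewiczSet.forall_models_iff {S : Set ℝ} (hS : IsLukasiewiczSet S)
    (P : ∀ W : Type u, (W → W → Prop) → Prop) (Γ : Finset ModalFormula) (φ : ModalFormula) :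
    (∀ M : KripkeModel.{u}, M.alg = hS.alg → M.Safe →
      P M.World M.R → ∀ v : M.World, (∀ γ ∈ Γ, M.Satisfies v γ) → M.Satisfies v φ) ↔
      RealConsequence P S Γ φ := by
  have hsat (W : Type u) [Nonempty W] (R : W → W → Prop) (e : ℕ → W → S) (ψ : ModalFormula)
      (v : W) : (hS.model W R e).Satisfies v ψ ↔ value R (fun i w => (e i w : ℝ)) ψ v = 1 :=
    (hS.hasValue_iff W R e ψ v ⟨1, hS.one_mem⟩).trans eq_comm
  constructor
  · intro H W R e hP he v hΓ
    have : Nonempty W := ⟨v⟩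
    let e' : ℕ → W → S := fun i w => ⟨e i w, he i w⟩
    exact (hsat W R e' φ v).1 (H (hS.model W R e') rfl
      (fun ψ w => ⟨⟨_, hS.value_mem he ψ w⟩, (hS.hasValue_iff W R e' ψ w _).2 rfl⟩) hP v
      fun γ hγ => (hsat W R e' γ v).2 (hΓ γ hγ))
  · rintro H ⟨_, W, R, e⟩ rfl - hP v hΓ
    exact (hsat W R e φ v).2 (H W R (fun i w => (e i w : S).1) hP (fun i w => (e i w : S).2) v
      fun γ hγ => (hsat W R e γ v).1 (hΓ γ hγ))

/-- The universe of `MV_n`. -/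
def finiteMVSet (n : ℕ+) : Set ℝ := {x : ℝ | ∃ k : ℕ, k ≤ (n : ℕ) ∧ x = (k : ℝ) / (n : ℕ)}

theorem finiteMVSet_subset (n : ℕ+) : finiteMVSet n ⊆ Set.Icc 0 1 := by
  rintro x ⟨k, hk, rfl⟩
  have hn : (0 : ℝ) < (n : ℕ) := by exact_mod_cast n.pos
  exact ⟨by positivity, (div_le_one hn).2 (by exact_mod_cast hk)⟩

theorem finite_finiteMVSet (n : ℕ+) : (finiteMVSet n).Finite := by
  refine ((Set.finite_Iic (n : ℕ)).image fun k : ℕ => (k : ℝ) / (n : ℕ)).subset ?_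
  rintro x ⟨k, hk, rfl⟩
  exact ⟨k, hk, rfl⟩

theorem isLukasiewiczSet_Icc : IsLukasiewiczSet (Set.Icc 0 1) where
  subset_Icc := subset_rfl
  zero_mem := by norm_num
  one_mem := by norm_num
  mul_mem := by intro a ha b hb; simp only [Set.mem_Icc] at *; grind
  imp_mem := by intro a ha b hb; simp only [Set.mem_Icc] at *; grind
  sInf_mem T hT := by
    have hpos : ∀ x ∈ insert 1 T, (0 : ℝ) ≤ x := by
      rintro x (rfl | hx)
      exacts [zero_le_one, (hT hx).1]
    exact ⟨le_csInf (Set.insert_nonempty _ _) hpos, csInf_le ⟨0, hpos⟩ (Or.inl rfl)⟩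

theorem value_mem_Icc {W : Type*} {R : W → W → Prop} {e : ℕ → W → ℝ}
    (he : ∀ i v, e i v ∈ Set.Icc (0 : ℝ) 1) (φ : ModalFormula) (v : W) :
    value R e φ v ∈ Set.Icc (0 : ℝ) 1 :=
  isLukasiewiczSet_Icc.value_mem he φ v

theorem mem_finiteMVSet_iff (n : ℕ+) (x : ℝ) :
    x ∈ finiteMVSet n ↔ x ∈ Set.Icc (0 : ℝ) 1 ∧ ∃ m : ℤ, x = m / (n : ℕ) := by
  have hn : (0 : ℝ) < (n : ℕ) := by exact_mod_cast n.pos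
  constructor
  · exact fun h => ⟨finiteMVSet_subset n h, h.elim fun k hk => ⟨k, by simpa using hk.2⟩⟩
  · rintro ⟨⟨h0, h1⟩, m, rfl⟩
    rw [le_div_iff₀ hn, zero_mul] at h0
    rw [div_le_one hn] at h1
    lift m to ℕ using by exact_mod_cast h0
    exact ⟨m, by exact_mod_cast h1, by simp⟩

theorem isLukasiewiczSet_finiteMVSet (n : ℕ+) : IsLukasiewiczSet (finiteMVSet n) := by
  have hn : (0 : ℝ) < (n : ℕ) := by exact_mod_cast n.pos
  have hzero : (0 : ℝ) ∈ finiteMVSet n := ⟨0, Nat.zero_le _, by simp⟩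
  have hone : (1 : ℝ) ∈ finiteMVSet n := ⟨n, le_rfl, (div_self hn.ne').symm⟩
  refine ⟨finiteMVSet_subset n, hzero, hone, fun a ha b hb => ?_, fun a ha b hb => ?_,
    fun T hT => ?_⟩
  · have := isLukasiewiczSet_Icc.mul_mem a (finiteMVSet_subset n ha) b (finiteMVSet_subset n hb)
    rcases max_choice 0 (a + b - 1) with h | h <;> rw [h] at this ⊢
    · exact hzero
    · obtain ⟨-, k, rfl⟩ := (mem_finiteMVSet_iff n a).1 ha
      obtain ⟨-, l, rfl⟩ := (mem_finiteMVSet_iff n b).1 hb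
      exact (mem_finiteMVSet_iff n _).2 ⟨this, k + l - (n : ℕ), by push_cast; field_simp⟩
  · have := isLukasiewiczSet_Icc.imp_mem a (finiteMVSet_subset n ha) b (finiteMVSet_subset n hb)
    rcases min_choice 1 (1 - a + b) with h | h <;> rw [h] at this ⊢
    · exact hone
    · obtain ⟨-, k, rfl⟩ := (mem_finiteMVSet_iff n a).1 ha
      obtain ⟨-, l, rfl⟩ := (mem_finiteMVSet_iff n b).1 hb
      exact (mem_finiteMVSet_iff n _).2 ⟨this, (n : ℕ) - k + l, by push_cast; field_simp⟩
  · rcases (Set.insert_nonempty _ _).csInf_mem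
      (((finite_finiteMVSet n).subset hT).insert 1) with h | h
    · rw [h]
      exact hone
    · exact hT h

theorem localConsequence_standardMV (P : ∀ W : Type u, (W → W → Prop) → Prop)
    (Γ : Finset ModalFormula) (φ : ModalFormula) :
    localConsequence {M : KripkeModel.{u} | M ∈ modelsL ∧ P M.World M.R} Γ φ ↔
      RealConsequence P (Set.Icc 0 1) Γ φ := by
  rw [← isLukasiewiczSet_Icc.forall_models_iff]
  exact ⟨fun H M hM hs hP => H M ⟨⟨hM, hs⟩, hP⟩, fun H M hM => H M hM.1.1 hM.1.2 hM.2⟩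

theorem localConsequence_finiteMV (P : ∀ W : Type u, (W → W → Prop) → Prop)
    (Γ : Finset ModalFormula) (φ : ModalFormula) :
    localConsequence {M : KripkeModel.{u} | M ∈ modelsFinL ∧ P M.World M.R} Γ φ ↔
      ∀ n, RealConsequence P (finiteMVSet n) Γ φ := by
  simp only [← (isLukasiewiczSet_finiteMVSet _).forall_models_iff]
  exact ⟨fun H n M hM hs hP => H M ⟨⟨⟨n, hM.symm⟩, hs⟩, hP⟩,
    fun H M hM => hM.1.1.elim fun n hn => H n M hn.symm hM.1.2 hM.2⟩

/-! ### Ultrapowers and witnessed models -/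

/-- The limit of a real sequence along a fixed nonprincipal ultrafilter. -/
noncomputable def ultraLim (f : ℕ → ℝ) : ℝ :=
  limUnder (hyperfilter ℕ : Filter ℕ) f

theorem tendsto_ultraLim {f : ℕ → ℝ} (hf : ∀ i, f i ∈ Set.Icc (0 : ℝ) 1) :
    Tendsto f (hyperfilter ℕ : Filter ℕ) (𝓝 (ultraLim f)) := by
  obtain ⟨x, -, hx⟩ := (isCompact_Icc (a := (0 : ℝ)) (b := 1)).ultrafilter_le_nhds
    ((hyperfilter ℕ).map f) (le_principal_iff.2 (Filter.mem_map.2 (Eventually.of_forall hf)))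
  exact tendsto_nhds_limUnder ⟨x, hx⟩

/-- The accessibility relation of the ultrapower of a frame. -/
def ultraRel {W : Type*} (R : W → W → Prop) (f g : ℕ → W) : Prop :=
  ∀ᶠ i in (hyperfilter ℕ : Filter ℕ), R (f i) (g i)

/-- Every value of the modality given by `boxVal` is attained, unless there are no successors. -/
def Witnessed {W : Type*} (R : W → W → Prop) (F : W → ℝ) : Prop :=
  ∀ v, (∃ w, R v w) → ∃ w, R v w ∧ F w = boxVal R F v

/-- Choose in coordinate `i` a successor whose value is within `1/(i+1)` of the infimum. The error
vanishes along the ultrafilter, so the class of these choices attains the infimum exactly, and the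
infimum commutes with the limit. -/
theorem boxVal_ultraRel {W : Type*} {R : W → W → Prop} {F : W → ℝ} {G : (ℕ → W) → ℝ}
    (hF : ∀ w, F w ∈ Set.Icc (0 : ℝ) 1)
    (hG : ∀ f, Tendsto (fun i => F (f i)) (hyperfilter ℕ : Filter ℕ) (𝓝 (G f))) :
    (∀ f, Tendsto (fun i => boxVal R F (f i)) (hyperfilter ℕ : Filter ℕ)
      (𝓝 (boxVal (ultraRel R) G f))) ∧ Witnessed (ultraRel R) G := by
  have key : ∀ f, (∃ h, ultraRel R f h) → ∃ g, ultraRel R f g ∧ G g = boxVal (ultraRel R) G f ∧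
      Tendsto (fun i => boxVal R F (f i)) (hyperfilter ℕ : Filter ℕ) (𝓝 (G g)) := by
    rintro f ⟨h, hh⟩
    have hex : ∀ i, ∃ w, (∃ u, R (f i) u) →
        R (f i) w ∧ F w < boxVal R F (f i) + 1 / ((i : ℝ) + 1) := fun i => by
      by_cases hi : ∃ u, R (f i) u
      · obtain ⟨w, hw⟩ := exists_lt_boxVal_add hF hi (Nat.one_div_pos_of_nat (n := i))
        exact ⟨w, fun _ => hw⟩
      · exact ⟨f i, fun h => (hi h).elim⟩
    choose g hg using hex
    have hev : ∀ᶠ i in (hyperfilter ℕ : Filter ℕ),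
        R (f i) (g i) ∧ F (g i) < boxVal R F (f i) + 1 / ((i : ℝ) + 1) :=
      hh.mono fun i hi => hg i ⟨_, hi⟩
    have hR : ultraRel R f g := hev.mono fun i hi => hi.1
    have hsmall : Tendsto (fun i : ℕ => 1 / ((i : ℝ) + 1)) (hyperfilter ℕ : Filter ℕ) (𝓝 0) :=
      tendsto_one_div_add_atTop_nhds_zero_nat.mono_left
        (hyperfilter_le_cofinite.trans Nat.cofinite_eq_atTop.le)
    have hlim : Tendsto (fun i => boxVal R F (f i)) (hyperfilter ℕ : Filter ℕ) (𝓝 (G g)) := by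
      refine tendsto_of_tendsto_of_tendsto_of_le_of_le' ((sub_zero (G g)) ▸ (hG g).sub hsmall) (hG g)
        (hev.mono fun i hi => ?_) (hev.mono fun i hi => boxVal_le (fun w => (hF w).1) hi.1)
      linarith [hi.2]
    refine ⟨g, hR, (boxVal_eq_of_forall_le hR ?_ fun k hk => ?_).symm, hlim⟩
    · exact le_of_tendsto (hG g) (Eventually.of_forall fun i => (hF _).2)
    · exact le_of_tendsto_of_tendsto hlim (hG k)
        (hk.mono fun i hi => boxVal_le (fun w => (hF w).1) hi)
  refine ⟨fun f => ?_, fun f hf => ?_⟩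
  · by_cases hf : ∃ h, ultraRel R f h
    · obtain ⟨g, -, hg, hlim⟩ := key f hf
      rwa [← hg]
    · rw [boxVal_eq_one hf]
      refine tendsto_const_nhds.congr' ?_
      -- If almost all coordinates had successors, choosing them would give a successor of `f`; so,
      -- by the ultrafilter property, almost all have none.
      have : ¬ ∀ᶠ i in (hyperfilter ℕ : Filter ℕ), ∃ w, R (f i) w := fun h => by
        have : ∀ i, ∃ w, (∃ u, R (f i) u) → R (f i) w := fun i => by
          by_cases hi : ∃ u, R (f i) u
          · exact hi.imp fun _ h _ => h
          · exact ⟨f i, fun h => (hi h).elim⟩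
        choose g hg using this
        exact hf ⟨g, h.mono fun i => hg i⟩
      exact (Ultrafilter.eventually_not.2 this).mono fun i hi => (boxVal_eq_one hi).symm
  · obtain ⟨g, hR, hg, -⟩ := key f hf
    exact ⟨g, hR, hg⟩

/-- A Łoś theorem for real truth values: the connectives are continuous, and `boxVal_ultraRel`
handles the modalities. -/
theorem tendsto_value_ultraRel {W : Type*} {R : W → W → Prop} {e : ℕ → W → ℝ}
    (he : ∀ i v, e i v ∈ Set.Icc (0 : ℝ) 1) (φ : ModalFormula) (f : ℕ → W) :
    Tendsto (fun i => value R e φ (f i)) (hyperfilter ℕ : Filter ℕ)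
      (𝓝 (value (ultraRel R) (fun j g => ultraLim fun i => e j (g i)) φ f)) := by
  induction φ generalizing f with
  | var j => exact tendsto_ultraLim fun i => he j (f i)
  | zero => exact tendsto_const_nhds
  | one => exact tendsto_const_nhds
  | and φ ψ hφ hψ => exact (hφ f).min (hψ f)
  | or φ ψ hφ hψ => exact (hφ f).max (hψ f)
  | mul φ ψ hφ hψ => exact tendsto_const_nhds.max (((hφ f).add (hψ f)).sub_const 1)
  | imp φ ψ hφ hψ => exact tendsto_const_nhds.min (((hφ f).const_sub 1).add (hψ f))
  | box φ hφ => exact (boxVal_ultraRel (value_mem_Icc he φ) hφ).1 f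
  | dia φ hφ =>
    refine ((boxVal_ultraRel (F := fun w => 1 - value R e φ w) (fun w => ?_)
      fun f => (hφ f).const_sub 1).1 f).const_sub 1
    exact isLukasiewiczSet_Icc.one_sub_mem (value_mem_Icc he φ w)

/-- Every pointed model has the same theory as a witnessed pointed model, namely its ultrapower. -/
theorem exists_witnessed {W : Type u} {R : W → W → Prop} {e : ℕ → W → ℝ}
    (he : ∀ i v, e i v ∈ Set.Icc (0 : ℝ) 1) (v : W) :
    ∃ (W' : Type u) (R' : W' → W' → Prop) (e' : ℕ → W' → ℝ) (v' : W'),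
      (∀ i w, e' i w ∈ Set.Icc (0 : ℝ) 1) ∧
      (∀ φ, Witnessed R' (value R' e' φ) ∧ Witnessed R' (fun w => 1 - value R' e' φ w)) ∧
      ∀ φ, value R' e' φ v' = value R e φ v := by
  refine ⟨ℕ → W, ultraRel R, fun j g => ultraLim fun i => e j (g i), fun _ => v, fun i w => ?_,
    fun φ => ⟨?_, ?_⟩, fun φ => ?_⟩
  · exact isClosed_Icc.mem_of_tendsto (tendsto_ultraLim fun j => he i (w j))
      (Eventually.of_forall fun j => he i (w j))
  · exact (boxVal_ultraRel (value_mem_Icc he φ) (tendsto_value_ultraRel he φ)).2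
  · exact (boxVal_ultraRel (F := fun w => 1 - value R e φ w)
      (fun w => isLukasiewiczSet_Icc.one_sub_mem (value_mem_Icc he φ w))
      fun f => (tendsto_value_ultraRel he φ f).const_sub 1).2
  · exact tendsto_nhds_unique (tendsto_value_ultraRel he φ fun _ => v) tendsto_const_nhds

/-! ### Order-preserving rational approximation -/

/-- A `ℚ`-linear map `ℝ → ℚ` may be chosen as close to the identity as desired on finitely many reals. -/
theorem exists_seq_linearMap_tendsto :
    ∃ L : ℕ → ℝ →ₗ[ℚ] ℚ, ∀ x, Tendsto (fun m => (L m x : ℝ)) atTop (𝓝 x) := by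
  -- Only the Hamel basis vectors need approximating: every real is a finite rational combination of
  -- them, so convergence follows.
  let b := Module.Basis.ofVectorSpace ℚ ℝ
  choose q _ _ hq using fun i => Real.exists_seq_rat_strictMono_tendsto (b i)
  refine ⟨fun m => b.constr ℚ fun i => q i m, fun x => ?_⟩
  have hx : ∑ i ∈ (b.repr x).support, (b.repr x i : ℝ) * b i = x := by
    conv_rhs => rw [← b.linearCombination_repr x]
    simp [Finsupp.linearCombination_apply, Finsupp.sum, Rat.smul_def]
  conv => enter [3, 1]; rw [← hx]
  have hL (m : ℕ) : ((b.constr ℚ (fun i => q i m) x : ℚ) : ℝ) =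
      ∑ i ∈ (b.repr x).support, (b.repr x i : ℝ) * (q i m : ℝ) := by
    simp [Module.Basis.constr_apply, Finsupp.sum]
  simp only [hL]
  exact tendsto_finsetSum _ fun i _ => (hq i).const_mul _

/-- Finitely many reals can be replaced by rationals with a common denominator in an additive way that
fixes `1` and preserves signs. -/
theorem exists_addMonoidHom_rational (D : Set ℝ) (hD : D.Finite) :
    ∃ (L : ℝ →+ ℝ) (n : ℕ+), L 1 = 1 ∧ (∀ x ∈ D, 0 < x → 0 < L x) ∧
      ∀ x ∈ D, ∃ m : ℤ, L x = m / (n : ℕ) := by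
  obtain ⟨L, hL⟩ := exists_seq_linearMap_tendsto
  have hev : ∀ᶠ m in atTop, ∀ x ∈ insert 1 D, 0 < x → (0 : ℝ) < L m x :=
    (eventually_all_finite (hD.insert 1)).2 fun x _ => by
      by_cases hx : 0 < x
      · exact ((hL x).eventually_const_lt hx).mono fun _ h _ => h
      · exact Eventually.of_forall fun _ h => (hx h).elim
  obtain ⟨m, hm⟩ := hev.exists
  have h1 : (0 : ℝ) < L m 1 := hm 1 (Or.inl rfl) one_pos
  -- Dividing by the positive rational `L m 1` fixes `1` and keeps signs.
  let q : ℝ → ℚ := fun x => (L m 1)⁻¹ * L m x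
  refine ⟨(Rat.castHom ℝ : ℚ →+ ℝ).comp ((AddMonoidHom.mulLeft (L m 1)⁻¹).comp (L m)),
    ⟨∏ x ∈ hD.toFinset, (q x).den, Finset.prod_pos fun x _ => (q x).pos⟩, ?_, fun x hx h => ?_,
    fun x hx => ?_⟩
  · have : L m 1 ≠ 0 := by exact_mod_cast h1.ne'
    simp [this]
  · have := hm x (Or.inr hx) h
    simp only [AddMonoidHom.comp_apply, AddMonoidHom.coe_mulLeft]
    simp
    positivity
  · obtain ⟨c, hc⟩ : (q x).den ∣ ∏ y ∈ hD.toFinset, (q y).den :=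
      Finset.dvd_prod_of_mem (fun y => (q y).den) (hD.mem_toFinset.2 hx)
    have hpos : 0 < ∏ y ∈ hD.toFinset, (q y).den := Finset.prod_pos fun x _ => (q x).pos
    refine ⟨(q x).num * c, ?_⟩
    change ((q x : ℚ) : ℝ) = _
    rw [PNat.mk_coe, hc]
    rw [hc] at hpos
    have hc0 : (c : ℝ) ≠ 0 := by
      rintro h
      simp [Nat.cast_eq_zero.1 h] at hpos
    have hd0 : ((q x).den : ℝ) ≠ 0 := by exact_mod_cast (q x).den_ne_zero
    conv_lhs => rw [← Rat.num_div_den (q x)]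
    push_cast
    field_simp

/-! ### Unravelling into finite levels -/

/-- The set of subformulas of a formula. -/
def ModalFormula.subformulas : ModalFormula → Set ModalFormula
  | .and φ ψ => insert (.and φ ψ) (φ.subformulas ∪ ψ.subformulas)
  | .or φ ψ => insert (.or φ ψ) (φ.subformulas ∪ ψ.subformulas)
  | .mul φ ψ => insert (.mul φ ψ) (φ.subformulas ∪ ψ.subformulas)
  | .imp φ ψ => insert (.imp φ ψ) (φ.subformulas ∪ ψ.subformulas)
  | .box φ => insert (.box φ) φ.subformulas
  | .dia φ => insert (.dia φ) φ.subformulas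
  | φ => {φ}

namespace ModalFormula

theorem finite_subformulas (φ : ModalFormula) : φ.subformulas.Finite := by
  induction φ with
  | var i => exact Set.finite_singleton _
  | zero => exact Set.finite_singleton _
  | one => exact Set.finite_singleton _
  | and φ ψ hφ hψ | or φ ψ hφ hψ | mul φ ψ hφ hψ | imp φ ψ hφ hψ => exact (hφ.union hψ).insert _
  | box φ hφ | dia φ hφ => exact hφ.insert _

theorem self_mem_subformulas (φ : ModalFormula) : φ ∈ φ.subformulas := by
  cases φ <;> simp [subformulas]

end ModalFormula

/-- The accessibility relation of the unravelling of `R` into levels, where `F k` are the worlds kept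
at level `k`. -/
def levelRel {W : Type*} (R : W → W → Prop) (F : ℕ → Set W) (x y : ℕ × W) : Prop :=
  y.1 = x.1 + 1 ∧ R x.2 y.2 ∧ y.2 ∈ F y.1

section level

variable {W : Type*} {R : W → W → Prop} {F : ℕ → Set W} {L : ℝ →+ ℝ} {V : Set ℝ}

/-- The infimum is attained at a kept world, and a monotone map preserves minima; a non-attained
infimum need not survive `L`. -/
theorem boxVal_levelRel (hL1 : L 1 = 1) (hL : MonotoneOn L V) (h1 : 1 ∈ V) {f : W → ℝ}
    {f' : ℕ × W → ℝ} {k : ℕ} {w : W} (hf : ∀ u, f u ∈ Set.Icc (0 : ℝ) 1)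
    (hwit : (∃ u, R w u) → ∃ u ∈ F (k + 1), R w u ∧ f u = boxVal R f w)
    (hV : ∀ u ∈ F (k + 1), f u ∈ V) (hf' : ∀ u ∈ F (k + 1), f' (k + 1, u) = L (f u)) :
    boxVal (levelRel R F) f' (k, w) = L (boxVal R f w) := by
  by_cases hs : ∃ u, R w u
  · obtain ⟨u, huF, hu, hfu⟩ := hwit hs
    have hle : f' (k + 1, u) ≤ 1 := by
      rw [hf' u huF, ← hL1]
      exact hL (hV u huF) h1 (hf u).2
    rw [← hfu, ← hf' u huF]
    refine boxVal_eq_of_forall_le ⟨rfl, hu, huF⟩ hle ?_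
    rintro ⟨j, t⟩ ⟨rfl : j = k + 1, ht, htF⟩
    rw [hf' u huF, hf' t htF]
    exact hL (hV u huF) (hV t htF) (hfu.trans_le (boxVal_le (fun w => (hf w).1) ht))
  · rw [boxVal_eq_one hs, boxVal_eq_one, hL1]
    exact fun ⟨y, hy⟩ => hs ⟨y.2, hy.2.1⟩

/-- The bound `k + sizeOf ψ ≤ d` keeps every evaluation within the levels whose values lie in `V`,
where `L` is monotone. -/
theorem value_levelRel (hL1 : L 1 = 1) (hL : MonotoneOn L V) (h1 : 1 ∈ V)
    (hneg : ∀ x ∈ V, 1 - x ∈ V) {e : ℕ → W → ℝ} {e' : ℕ → ℕ × W → ℝ}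
    (he : ∀ i w, e i w ∈ Set.Icc (0 : ℝ) 1) {S : Set ModalFormula} {d : ℕ}
    (hV : ∀ k ≤ d, ∀ w ∈ F k, ∀ ψ ∈ S, value R e ψ w ∈ V)
    (hbox : ∀ ψ ∈ S, ∀ k, ∀ w ∈ F k, (∃ u, R w u) →
      ∃ u ∈ F (k + 1), R w u ∧ value R e ψ u = boxVal R (value R e ψ) w)
    (hdia : ∀ ψ ∈ S, ∀ k, ∀ w ∈ F k, (∃ u, R w u) →
      ∃ u ∈ F (k + 1), R w u ∧ 1 - value R e ψ u = boxVal R (fun w => 1 - value R e ψ w) w)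
    (he' : ∀ i k w, L (e i w) ∈ L '' V → e' i (k, w) = L (e i w)) (ψ : ModalFormula)
    (hψ : ψ.subformulas ⊆ S) (k : ℕ) (hk : k + sizeOf ψ ≤ d) (w : W) (hw : w ∈ F k) :
    value (levelRel R F) e' ψ (k, w) = L (value R e ψ w) := by
  have hself (ψ : ModalFormula) (hψ : ψ.subformulas ⊆ S) : ψ ∈ S := hψ ψ.self_mem_subformulas
  -- Truncation depends on comparing `x + y` with `1`. The sum may lie outside `V`, so `x` is
  -- compared with `1 - y` instead.
  have hcompl {x y : ℝ} (hx : x ∈ V) (hy : y ∈ V) :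
      (x + y ≤ 1 → L x + L y ≤ 1) ∧ (1 ≤ x + y → 1 ≤ L x + L y) := by
    constructor
    · intro h
      have := hL hx (hneg y hy) (by linarith)
      rw [map_sub, hL1] at this
      linarith
    · intro h
      have := hL (hneg y hy) hx (by linarith)
      rw [map_sub, hL1] at this
      linarith
  induction ψ generalizing k w with
  | var i => exact he' i k w ⟨_, hV k (by omega) w hw _ (hself _ hψ), rfl⟩
  | zero => exact (map_zero L).symm
  | one => exact hL1.symm
  | and φ ψ hφ' hψ' =>
    simp only [ModalFormula.subformulas, Set.insert_subset_iff, Set.union_subset_iff] at hψ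
    simp only [ModalFormula.and.sizeOf_spec] at hk
    have hx := hV k (by omega) w hw _ (hself _ hψ.2.1)
    have hy := hV k (by omega) w hw _ (hself _ hψ.2.2)
    simp only [value]
    rw [hφ' hψ.2.1 k (by omega) w hw, hψ' hψ.2.2 k (by omega) w hw]
    exact (hL.map_min hx hy).symm
  | or φ ψ hφ' hψ' =>
    simp only [ModalFormula.subformulas, Set.insert_subset_iff, Set.union_subset_iff] at hψ
    simp only [ModalFormula.or.sizeOf_spec] at hk
    have hx := hV k (by omega) w hw _ (hself _ hψ.2.1)
    have hy := hV k (by omega) w hw _ (hself _ hψ.2.2)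
    simp only [value]
    rw [hφ' hψ.2.1 k (by omega) w hw, hψ' hψ.2.2 k (by omega) w hw]
    exact (hL.map_max hx hy).symm
  | mul φ ψ hφ' hψ' =>
    simp only [ModalFormula.subformulas, Set.insert_subset_iff, Set.union_subset_iff] at hψ
    simp only [ModalFormula.mul.sizeOf_spec] at hk
    have hx := hV k (by omega) w hw _ (hself _ hψ.2.1)
    have hy := hV k (by omega) w hw _ (hself _ hψ.2.2)
    simp only [value]
    rw [hφ' hψ.2.1 k (by omega) w hw, hψ' hψ.2.2 k (by omega) w hw]
    rcases le_total (value R e φ w + value R e ψ w) 1 with h | h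
    · rw [max_eq_left (sub_nonpos.2 ((hcompl hx hy).1 h)), max_eq_left (sub_nonpos.2 h), map_zero]
    · rw [max_eq_right (sub_nonneg.2 ((hcompl hx hy).2 h)), max_eq_right (sub_nonneg.2 h), map_sub,
        map_add, hL1]
  | imp φ ψ hφ' hψ' =>
    simp only [ModalFormula.subformulas, Set.insert_subset_iff, Set.union_subset_iff] at hψ
    simp only [ModalFormula.imp.sizeOf_spec] at hk
    have hx := hV k (by omega) w hw _ (hself _ hψ.2.1)
    have hy := hV k (by omega) w hw _ (hself _ hψ.2.2)
    simp only [value]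
    rw [hφ' hψ.2.1 k (by omega) w hw, hψ' hψ.2.2 k (by omega) w hw]
    rcases le_total (value R e φ w) (value R e ψ w) with h | h
    · have h' : L (value R e φ w) ≤ L (value R e ψ w) := hL hx hy h
      rw [min_eq_left (by linarith), min_eq_left (by linarith), hL1]
    · have h' : L (value R e ψ w) ≤ L (value R e φ w) := hL hy hx h
      rw [min_eq_right (by linarith), min_eq_right (by linarith), map_add, map_sub, hL1]
  | box φ hφ =>
    simp only [ModalFormula.subformulas, Set.insert_subset_iff] at hψ
    simp only [ModalFormula.box.sizeOf_spec] at hk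
    have hφS := hself _ hψ.2
    exact boxVal_levelRel hL1 hL h1 (value_mem_Icc he φ) (hbox φ hφS k w hw)
      (fun u hu => hV (k + 1) (by omega) u hu φ hφS) fun u hu => hφ hψ.2 (k + 1) (by omega) u hu
  | dia φ hφ =>
    simp only [ModalFormula.subformulas, Set.insert_subset_iff] at hψ
    simp only [ModalFormula.dia.sizeOf_spec] at hk
    have hφS := hself _ hψ.2
    simp only [value]
    rw [boxVal_levelRel hL1 hL h1
      (fun u => isLukasiewiczSet_Icc.one_sub_mem (value_mem_Icc he φ u)) (hdia φ hφS k w hw)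
      (fun u hu => hneg _ (hV (k + 1) (by omega) u hu φ hφS))
      fun u hu => by rw [hφ hψ.2 (k + 1) (by omega) u hu, map_sub, hL1], map_sub, hL1]

end level

/-- A witnessed pointed model has, as far as finitely many formulas are concerned, the same theory as a
model over some `MV_n`. -/
theorem exists_finiteMV_model {W : Type u} {R : W → W → Prop} {e : ℕ → W → ℝ}
    (he : ∀ i w, e i w ∈ Set.Icc (0 : ℝ) 1)
    (hwit : ∀ φ, Witnessed R (value R e φ) ∧ Witnessed R (fun w => 1 - value R e φ w)) (v : W)
    (Γ : Set ModalFormula) (hΓ : Γ.Finite) :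
    ∃ (n : ℕ+) (R' : ℕ × W → ℕ × W → Prop) (e' : ℕ → ℕ × W → ℝ) (v' : ℕ × W),
      (∀ i w, e' i w ∈ finiteMVSet n) ∧
      ∀ φ ∈ Γ, value R' e' φ v' = 1 ↔ value R e φ v = 1 := by
  classical
  let S : Set ModalFormula := ⋃ φ ∈ Γ, φ.subformulas
  have hS : S.Finite := hΓ.biUnion fun φ _ => φ.finite_subformulas
  have hΓS : ∀ φ ∈ Γ, φ.subformulas ⊆ S := fun φ hφ => Set.subset_biUnion_of_mem hφ
  obtain ⟨d, hd⟩ := (hΓ.image sizeOf).bddAbove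
  have hbox : ∀ φ w, ∃ u, (∃ u, R w u) → R w u ∧ value R e φ u = boxVal R (value R e φ) w :=
    fun φ w => by
      by_cases h : ∃ u, R w u
      · obtain ⟨u, hu⟩ := (hwit φ).1 w h
        exact ⟨u, fun _ => hu⟩
      · exact ⟨w, fun h' => (h h').elim⟩
  have hdia : ∀ φ w, ∃ u, (∃ u, R w u) →
      R w u ∧ 1 - value R e φ u = boxVal R (fun w => 1 - value R e φ w) w :=
    fun φ w => by
      by_cases h : ∃ u, R w u
      · obtain ⟨u, hu⟩ := (hwit φ).2 w h
        exact ⟨u, fun _ => hu⟩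
      · exact ⟨w, fun h' => (h h').elim⟩
  choose g hg using hbox
  choose g' hg' using hdia
  -- Each level consists of the chosen witnesses, for both modalities and all formulas in `S`, of
  -- the worlds one level up.
  let F : ℕ → Set W := fun k =>
    Nat.rec {v} (fun _ A => Set.image2 g S A ∪ Set.image2 g' S A) k
  have hF (k : ℕ) : (F k).Finite := by
    induction k with
    | zero => exact Set.finite_singleton v
    | succ k ih => exact (hS.image2 _ ih).union (hS.image2 _ ih)
  let V₀ : Set ℝ := insert 1 (⋃ k ∈ Set.Iic d, Set.image2 (value R e) S (F k))
  have hV₀ : V₀.Finite :=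
    ((Set.finite_Iic d).biUnion fun k _ => hS.image2 _ (hF k)).insert 1
  have hV₀Icc : V₀ ⊆ Set.Icc 0 1 := by
    refine Set.insert_subset (by norm_num) (Set.iUnion₂_subset fun k _ => ?_)
    rintro _ ⟨φ, -, w, -, rfl⟩
    exact value_mem_Icc he φ w
  let V : Set ℝ := V₀ ∪ (fun x => 1 - x) '' V₀
  have hVfin : V.Finite := hV₀.union (hV₀.image _)
  have hneg : ∀ x ∈ V, 1 - x ∈ V := by
    rintro x (hx | ⟨y, hy, rfl⟩)
    · exact Or.inr ⟨x, hx, rfl⟩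
    · exact Or.inl (by simpa using hy)
  have hVIcc : V ⊆ Set.Icc 0 1 := by
    rintro x (hx | ⟨y, hy, rfl⟩)
    · exact hV₀Icc hx
    · exact isLukasiewiczSet_Icc.one_sub_mem (hV₀Icc hy)
  have h1 : 1 ∈ V := Or.inl (Or.inl rfl)
  have h0 : 0 ∈ V := by simpa using hneg 1 h1
  have hmem : ∀ k ≤ d, ∀ w ∈ F k, ∀ ψ ∈ S, value R e ψ w ∈ V := fun k hk w hw ψ hψ =>
    Or.inl (Or.inr (Set.mem_biUnion hk ⟨ψ, hψ, w, hw, rfl⟩))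
  obtain ⟨L, n, hL1, hpos, hrat⟩ :=
    -- Positivity on differences is strict monotonicity on `V`; since `0 ∈ V`, the differences
    -- include `V` itself, which gives the denominators.
    exists_addMonoidHom_rational (Set.image2 (fun x y => x - y) V V) (hVfin.image2 _ hVfin)
  have hL : StrictMonoOn L V := fun x hx y hy hxy => by
    have := hpos (y - x) ⟨y, hy, x, hx, rfl⟩ (sub_pos.2 hxy)
    rwa [map_sub, sub_pos] at this
  have hLn : ∀ x ∈ V, L x ∈ finiteMVSet n := fun x hx => by
    refine (mem_finiteMVSet_iff n _).2 ⟨⟨?_, ?_⟩, hrat x ⟨x, hx, 0, h0, sub_zero x⟩⟩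
    · simpa using hL.monotoneOn h0 hx (hVIcc hx).1
    · simpa [hL1] using hL.monotoneOn hx h1 (hVIcc hx).2
  -- Beyond depth `d`, or for variables outside `S`, `L` may leave `MV_n`; the default `0` is
  -- harmless there.
  let e' : ℕ → ℕ × W → ℝ := fun i x => if L (e i x.2) ∈ finiteMVSet n then L (e i x.2) else 0
  refine ⟨n, levelRel R F, e', (0, v), fun i x => ?_, fun φ hφ => ?_⟩
  · by_cases h : L (e i x.2) ∈ finiteMVSet n
    · simpa only [e', if_pos h] using h
    · simpa only [e', if_neg h] using (isLukasiewiczSet_finiteMVSet n).zero_mem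
  · have hval := value_levelRel (F := F) (e' := e') (d := d) hL1 hL.monotoneOn h1 hneg he hmem
      (fun ψ hψ k w hw hs => ⟨g ψ w, Or.inl ⟨ψ, hψ, w, hw, rfl⟩, hg ψ w hs⟩)
      (fun ψ hψ k w hw hs => ⟨g' ψ w, Or.inr ⟨ψ, hψ, w, hw, rfl⟩, hg' ψ w hs⟩)
      (fun i k w ⟨x, hx, hxe⟩ => if_pos (by simpa only [← hxe] using hLn x hx))
      φ (hΓS φ hφ) 0 (by simpa using hd ⟨φ, hφ, rfl⟩) v rfl
    rw [hval]
    nth_rewrite 1 [← hL1]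
    exact hL.injOn.eq_iff
      (hmem 0 (Nat.zero_le d) v rfl φ (hΓS φ hφ φ.self_mem_subformulas)) h1

theorem realConsequence_Icc_iff (Γ : Finset ModalFormula) (φ : ModalFormula) :
    (∀ n, RealConsequence.{u} (fun _ _ => True) (finiteMVSet n) Γ φ) ↔
      RealConsequence.{u} (fun _ _ => True) (Set.Icc 0 1) Γ φ := by
  constructor
  · intro H W R e _ he v hΓ
    obtain ⟨W₁, R₁, e₁, v₁, he₁, hwit, hv₁⟩ := exists_witnessed he v
    obtain ⟨n, R₂, e₂, v₂, he₂, hv₂⟩ := exists_finiteMV_model he₁ hwit v₁ (insert φ Γ)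
      (Γ.finite_toSet.insert φ)
    rw [← hv₁, ← hv₂ φ (Or.inl rfl)]
    refine H n _ R₂ e₂ trivial he₂ v₂ fun γ hγ => ?_
    rw [hv₂ γ (Or.inr hγ), hv₁]
    exact hΓ γ hγ
  · exact fun H n W R e hP he => H W R e hP fun i w => finiteMVSet_subset n (he i w)

/-! ### Separating the transitive logics -/

namespace ModalFormula

/-- The formula `φ ⊕ φ`, that is, `¬φ → φ`. -/
def double (φ : ModalFormula) : ModalFormula := .imp (.imp φ .zero) φ

/-- `p₀` is equivalent to `◇p₀ ⊕ ◇p₀`. -/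
def halving : ModalFormula :=
  .and (.imp (.var 0) (double (.dia (.var 0)))) (.imp (double (.dia (.var 0))) (.var 0))

/-- `p₀` is equivalent to `¬p₀`. -/
def oneHalf : ModalFormula :=
  .and (.imp (.var 0) (.imp (.var 0) .zero)) (.imp (.imp (.var 0) .zero) (.var 0))

end ModalFormula

section halving

open ModalFormula

variable {W : Type*} {R : W → W → Prop} {e : ℕ → W → ℝ}

theorem value_oneHalf_eq_one_iff (he : ∀ i w, e i w ∈ Set.Icc (0 : ℝ) 1) (v : W) :
    value R e oneHalf v = 1 ↔ e 0 v = 1 / 2 := by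
  have := he 0 v
  simp only [oneHalf, value, Set.mem_Icc] at *
  grind

theorem value_halving_eq_one_iff (he : ∀ i w, e i w ∈ Set.Icc (0 : ℝ) 1) (v : W) :
    value R e halving v = 1 ↔ e 0 v = min 1 (2 * value R e (dia (var 0)) v) := by
  have := he 0 v
  have h := value_mem_Icc (R := R) he (dia (var 0)) v
  simp only [halving, double, value, Set.mem_Icc] at *
  grind

theorem value_box_eq_one_iff (he : ∀ i w, e i w ∈ Set.Icc (0 : ℝ) 1) (φ : ModalFormula) (v : W) :
    value R e (.box φ) v = 1 ↔ ∀ w, R v w → value R e φ w = 1 := by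
  have hφ := value_mem_Icc (R := R) he φ
  constructor
  · intro h w hw
    exact le_antisymm (hφ w).2 (h.symm.trans_le (boxVal_le (fun w => (hφ w).1) hw))
  · intro h
    by_cases hs : ∃ w, R v w
    · obtain ⟨w, hw⟩ := hs
      rw [← h w hw]
      exact boxVal_eq_of_forall_le hw (hφ w).2 fun u hu => ((h w hw).trans (h u hu).symm).le
    · exact boxVal_eq_one hs

end halving

/-- A set of premises that is satisfiable in a transitive model over `[0,1]_Ł`, but not in one over a
finite chain. -/
noncomputable def halvingPremises : Finset ModalFormula :=
  letI := Classical.decEq ModalFormula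
  {.oneHalf, .halving, .box .halving}

theorem forall_mem_halvingPremises_iff {W : Type*} {R : W → W → Prop} {e : ℕ → W → ℝ}
    (he : ∀ i w, e i w ∈ Set.Icc (0 : ℝ) 1) (v : W) :
    (∀ γ ∈ halvingPremises, value R e γ v = 1) ↔ e 0 v = 1 / 2 ∧
      ∀ w, w = v ∨ R v w → e 0 w = min 1 (2 * value R e (.dia (.var 0)) w) := by
  simp [halvingPremises, value_oneHalf_eq_one_iff he, value_halving_eq_one_iff he,
    value_box_eq_one_iff he, or_imp, forall_and]

theorem realConsequence_halvingPremises (n : ℕ+) :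
    RealConsequence.{u} (fun _ R => ∀ x y z, R x y → R y z → R x z) (finiteMVSet n)
      halvingPremises .zero := by
  intro W R e htrans he v hv
  exfalso
  have hn : (0 : ℝ) < (n : ℕ) := by exact_mod_cast n.pos
  have heIcc : ∀ i w, e i w ∈ Set.Icc (0 : ℝ) 1 := fun i w => finiteMVSet_subset n (he i w)
  obtain ⟨hhalf, hdbl⟩ := (forall_mem_halvingPremises_iff heIcc v).1 hv
  have hstep : ∀ w, w = v ∨ R v w → 0 < e 0 w → e 0 w ≤ 1 / 2 →
      ∃ u, R v u ∧ e 0 w = 2 * e 0 u := by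
    intro w hw h0 h1
    have h2 := hdbl w hw
    have h3 : e 0 w = 2 * value R e (.dia (.var 0)) w := by
      rcases min_choice 1 (2 * value R e (.dia (.var 0)) w) with h | h <;> rw [h] at h2
      · linarith
      · exact h2
    have hfin : (insert 1 ((fun u => 1 - e 0 u) '' {u | R w u})).Finite := by
      refine (finite_finiteMVSet n).subset (Set.insert_subset
        (isLukasiewiczSet_finiteMVSet n).one_mem ?_)
      rintro _ ⟨u, -, rfl⟩
      exact (isLukasiewiczSet_finiteMVSet n).one_sub_mem (he 0 u)
    have hval : value R e (.dia (.var 0)) w =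
        1 - sInf (insert 1 ((fun u => 1 - e 0 u) '' {u | R w u})) := rfl
    -- If the infimum is the inserted `1`, then `◇p₀` is `0`, contradicting `0 < e 0 w`; otherwise a
    -- successor attains the supremum.
    rcases (Set.insert_nonempty _ _).csInf_mem hfin with h | ⟨u, hu, h⟩
    · rw [hval, h] at h3
      linarith
    · rw [hval, ← h] at h3
      refine ⟨u, ?_, by linarith⟩
      rcases hw with rfl | hw
      exacts [hu, htrans _ _ _ hw hu]
  -- Infinite descent on the numerator `k`: each halving strictly decreases it.
  have key : ∀ k : ℕ, ∀ w, w = v ∨ R v w → 0 < e 0 w → e 0 w ≤ 1 / 2 →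
      e 0 w ≠ (k : ℝ) / (n : ℕ) := by
    intro k
    induction k using Nat.strong_induction_on with
    | _ k ih =>
      intro w hw h0 h1 hk
      obtain ⟨u, hu, hwu⟩ := hstep w hw h0 h1
      obtain ⟨j, -, hj⟩ := he 0 u
      refine ih j ?_ u (Or.inr hu) (by linarith) (by linarith) hj
      have : (j : ℝ) / (n : ℕ) < k / (n : ℕ) := by linarith
      exact_mod_cast (div_lt_div_iff_of_pos_right hn).1 this
  obtain ⟨k, -, hk⟩ := he 0 v
  exact key k v (Or.inl rfl) (by rw [hhalf]; norm_num) hhalf.le hk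

theorem not_realConsequence_halvingPremises :
    ¬ RealConsequence.{u} (fun _ R => ∀ x y z, R x y → R y z → R x z) (Set.Icc 0 1)
      halvingPremises .zero := by
  intro H
  -- The values `2^-(x+1)` decrease strictly, so the supremum over all later worlds is attained at
  -- the next one and equals half the current value.
  let R : ULift.{u} ℕ → ULift.{u} ℕ → Prop := fun x y => x.down < y.down
  let e : ℕ → ULift.{u} ℕ → ℝ := fun _ x => (1 / 2) ^ (x.down + 1)
  have he : ∀ i w, e i w ∈ Set.Icc (0 : ℝ) 1 := fun i w =>
    ⟨by positivity, pow_le_one₀ (by norm_num) (by norm_num)⟩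
  have := H (ULift.{u} ℕ) R e (fun x y z => lt_trans) he ⟨0⟩
    ((forall_mem_halvingPremises_iff he _).2 ⟨by simp [e], fun w _ => ?_⟩)
  · exact zero_ne_one this
  · have hbox : boxVal R (fun x => 1 - e 0 x) w = 1 - (1 / 2) ^ (w.down + 2) := by
      refine boxVal_eq_of_forall_le (F := fun x => 1 - e 0 x) (w := ⟨w.down + 1⟩)
        (Nat.lt_succ_self _) (sub_le_self _ (he 0 _).1) fun u hu => sub_le_sub_left ?_ 1
      exact pow_le_pow_of_le_one (by norm_num) (by norm_num) (Nat.succ_le_succ hu)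
    have hval : value R e (.dia (.var 0)) w = (1 / 2) ^ (w.down + 2) := by
      change 1 - boxVal R (fun x => 1 - e 0 x) w = _
      rw [hbox, sub_sub_cancel]
    have : 2 * value R e (.dia (.var 0)) w = e 0 w := by
      rw [hval]
      simp only [e]
      ring
    rw [this, min_eq_right (he 0 w).2]

theorem mainTheorem5 :
    -- the minimal local modal logics coincide
    (∀ (Γ : Finset ModalFormula) (φ : ModalFormula),
      localConsequence modelsFinL.{u} Γ φ ↔ localConsequence modelsL.{u} Γ φ) ∧
    -- the transitive logic over finite MV chains is strictly stronger than the one over `[0,1]_Ł`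
    ((∀ (Γ : Finset ModalFormula) (φ : ModalFormula),
        localConsequence (transitiveModels modelsL.{u}) Γ φ →
          localConsequence (transitiveModels modelsFinL.{u}) Γ φ) ∧
      ∃ (Γ : Finset ModalFormula) (φ : ModalFormula),
        localConsequence (transitiveModels modelsFinL.{u}) Γ φ ∧
          ¬ localConsequence (transitiveModels modelsL.{u}) Γ φ) ∧
    -- no set of axioms and rules turns both minimal logics into their transitive versions
    ¬ ∃ G : AxiomsAndRules,
        (∀ (Γ : Finset ModalFormula) (φ : ModalFormula),
          extension (localConsequence modelsL.{u}) G Γ φ ↔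
            localConsequence (transitiveModels modelsL.{u}) Γ φ) ∧
        (∀ (Γ : Finset ModalFormula) (φ : ModalFormula),
          extension (localConsequence modelsFinL.{u}) G Γ φ ↔
            localConsequence (transitiveModels modelsFinL.{u}) Γ φ) := by
  have hmin (Γ : Finset ModalFormula) (φ : ModalFormula) :
      localConsequence modelsFinL.{u} Γ φ ↔ localConsequence modelsL.{u} Γ φ := by
    have h1 := localConsequence_finiteMV.{u} (fun _ _ => True) Γ φ
    have h2 := localConsequence_standardMV.{u} (fun _ _ => True) Γ φ
    simp only [and_true, Set.ofPred_mem_eq] at h1 h2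
    rw [h1, h2, realConsequence_Icc_iff]
  have hL := localConsequence_standardMV.{u} fun _ R => ∀ x y z, R x y → R y z → R x z
  have hFin := localConsequence_finiteMV.{u} fun _ R => ∀ x y z, R x y → R y z → R x z
  have hstrict : ∃ (Γ : Finset ModalFormula) (φ : ModalFormula),
      localConsequence (transitiveModels modelsFinL.{u}) Γ φ ∧
        ¬ localConsequence (transitiveModels modelsL.{u}) Γ φ :=
    ⟨halvingPremises, .zero, (hFin _ _).2 realConsequence_halvingPremises,
      fun h => not_realConsequence_halvingPremises ((hL _ _).1 h)⟩
  refine ⟨hmin, ⟨fun Γ φ h => (hFin Γ φ).2 fun n W R e hP he => (hL Γ φ).1 h W R e hP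
    fun i w => finiteMVSet_subset n (he i w), hstrict⟩, ?_⟩
  rintro ⟨G, h1, h2⟩
  obtain ⟨Γ, φ, hΓ, hΓ'⟩ := hstrict
  -- `extension` depends on the base logic only as a relation, so nothing about `G` is needed.
  have : localConsequence modelsFinL.{u} = localConsequence modelsL.{u} :=
    funext₂ fun Γ φ => propext (hmin Γ φ)
  rw [← h2, this, h1] at hΓ
  exact hΓ' hΓ
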